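/- Let $m,n$ be natural numbers, let $\mathbb{A}=(A_1,\dots,A_n)$ be an $n$-tuple of positive definite complex $m\times m$ matrices, let $\omega=(w_1,\dots,w_n)$ be a probability vector ($w_j\ge 0$, $\sum_j w_j=1$), and let $t\in(0,1)$. Write $\le$ for the Loewner order ($A\le B$ iff $B-A$ is positive semidefinite). Let $$\varphi_t(X)=\sum_{j=1}^n w_j\Big[\operatorname{tr}\big((1-t)A_j+tX\big)-\operatorname{tr}\Big(A_j^{\frac{1-t}{2t}}XA_j^{\frac{1-t}{2t}}\Big)^{t}\Big].$$ Then $\varphi_t$ has exactly one minimizer over the positive definite $m\times m$ matrices $X$; this minimizer is the parameterized Wasserstein mean $\Omega_t(\omega;\mathbb{A})$. For positive definite matrices $B_1,\dots,B_n$ denote by $\mathcal{A}(\omega;B_1,\dots,B_n)=\sum_{j} w_jB_j$ and $\mathcal{H}(\omega;B_1,\dots,B_n)=\big(\sum_{j} w_jB_j^{-1}\big)^{-1}$ the weighted arithmetic and harmonic means. Then: 1. If $\Omega_t(\omega;\mathbb{A})\ge I$, then $\mathcal{A}(\omega;A_1^{1-t},\dots,A_n^{1-t})\ge I$. 2. If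 $\Omega_t(\omega;\mathbb{A})\le I$, then $\Omega_t(\omega;\mathbb{A})\le\mathcal{H}(\omega;A_1^{t-1},\dots,A_n^{t-1})$. -/

import Mathlib

open scoped ComplexOrder MatrixOrder

/-! Complex `m × m` matrices carry the Loewner order `A ≤ B ↔ (B - A).PosSemidef`, and `A ^ r` for a
real number `r` is the power of a positive (semi)definite matrix in the sense of the functional
calculus. -/

noncomputable section

namespace ParamWasserstein

/-- The weighted arithmetic mean `∑ j, w j • A j`. -/
def arithmeticMean {m n : ℕ} (w : Fin n → ℝ) (A : Fin n → Matrix (Fin m) (Fin m) ℂ) :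
    Matrix (Fin m) (Fin m) ℂ :=
  ∑ j, w j • A j

/-- The weighted harmonic mean `(∑ j, w j • (A j)⁻¹)⁻¹`. -/
def harmonicMean {m n : ℕ} (w : Fin n → ℝ) (A : Fin n → Matrix (Fin m) (Fin m) ℂ) :
    Matrix (Fin m) (Fin m) ℂ :=
  (∑ j, w j • (A j)⁻¹)⁻¹

/-- The objective function
`∑ j, w j * [tr ((1 - t) A j + t X) - tr ((A j) ^ ((1-t)/(2t)) X (A j) ^ ((1-t)/(2t))) ^ t]`.
For positive definite `A j` and `X` the traces are real; they are read as real numbers. -/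
def objective {m n : ℕ} (t : ℝ) (w : Fin n → ℝ) (A : Fin n → Matrix (Fin m) (Fin m) ℂ)
    (X : Matrix (Fin m) (Fin m) ℂ) : ℝ :=
  ∑ j, w j *
    ((Matrix.trace ((1 - t) • A j + t • X)).re -
      (Matrix.trace
        ((A j ^ ((1 - t) / (2 * t)) * X * A j ^ ((1 - t) / (2 * t))) ^ t)).re)

/-- `X` is a minimizer of the objective function over the positive definite matrices. -/
def IsMinimizer {m n : ℕ} (t : ℝ) (w : Fin n → ℝ) (A : Fin n → Matrix (Fin m) (Fin m) ℂ)
    (X : Matrix (Fin m) (Fin m) ℂ) : Prop :=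
  X.PosDef ∧ ∀ Y : Matrix (Fin m) (Fin m) ℂ, Y.PosDef → objective t w A X ≤ objective t w A Y

open Classical in
/-- The parameterized Wasserstein mean: the minimizer of the objective function over the positive
definite matrices (and `0` if there is none). -/
def wassersteinMean {m n : ℕ} (t : ℝ) (w : Fin n → ℝ) (A : Fin n → Matrix (Fin m) (Fin m) ℂ) :
    Matrix (Fin m) (Fin m) ℂ :=
  if h : ∃ X, IsMinimizer t w A X then h.choose else 0

end ParamWasserstein

end

/-! The function `X ↦ tr X ^ t` is strictly concave on positive definite matrices, so the objective
is strictly convex, with gradient `t • (1 - grad t w A X)`. A positive definite solution of `grad t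
w A X = 1` is therefore the unique minimizer (`objective_tangent_le`, which rests on Klein's
inequality `trace_rpow_le_tangent`).

Such a solution comes from compactness. If `a ≤ A j ≤ b` for all `j`, minimize over a slightly
larger order interval of scalar bounds. Comparing `grad` with `c ^ (1 - t) • X ^ (t - 1)` and
truncating the spectrum of the minimizer shows that it still lies between `a` and `b`, hence away
from the boundary, so the first order condition forces the gradient to vanish
(`exists_grad_eq_one`).

Both inequalities then follow from two facts: `gradTerm t A X` is antitone in `X` (`gradTerm_anti`)
and equals `A ^ (1 - t)` at `X = 1` (`gradTerm_one`). Comparing `grad` at the mean, where it is `1`,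
with `grad` at `1` bounds `∑ w j • A j ^ (1 - t)` by `1` from one side or the other; in the second
case inversion bounds the harmonic mean below by `1`. -/

namespace ParamWasserstein

open Matrix Filter Topology

section

open scoped Matrix.Norms.L2Operator

variable {ι : Type*} [Fintype ι] [DecidableEq ι]

/-! ### Klein's trace inequality -/

/-- The trace of a product of functions of two Hermitian matrices, in terms of the eigenvalues and
the overlaps of the eigenbases. -/
lemma trace_cfc_mul_cfc {P Q : Matrix ι ι ℂ} (hP : P.IsHermitian) (hQ : Q.IsHermitian)
    (f g : ℝ → ℝ) :
    (cfc f P * cfc g Q).trace.re = ∑ i, ∑ j, f (hP.eigenvalues i) * g (hQ.eigenvalues j) *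
      ‖(star (hP.eigenvectorUnitary : Matrix ι ι ℂ) * hQ.eigenvectorUnitary) i j‖ ^ 2 := by
  set U := (hP.eigenvectorUnitary : Matrix ι ι ℂ)
  set V := (hQ.eigenvectorUnitary : Matrix ι ι ℂ)
  set W := star U * V with hW
  have hW' : star W = star V * U := by simp [hW]
  rw [hP.cfc_eq, hQ.cfc_eq, IsHermitian.cfc, IsHermitian.cfc, Unitary.conjStarAlgAut_apply,
    Unitary.conjStarAlgAut_apply]
  have h : (U * diagonal (RCLike.ofReal ∘ f ∘ hP.eigenvalues) * star U *
      (V * diagonal (RCLike.ofReal ∘ g ∘ hQ.eigenvalues) * star V)).trace =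
      (diagonal (RCLike.ofReal ∘ f ∘ hP.eigenvalues) * W *
        (diagonal (RCLike.ofReal ∘ g ∘ hQ.eigenvalues) * star W)).trace := by
    rw [hW', hW]
    simp only [mul_assoc]
    rw [trace_mul_comm U]
    simp only [mul_assoc]
  refine (congrArg Complex.re h).trans ?_
  rw [trace, Complex.re_sum]
  refine Finset.sum_congr rfl fun i _ => ?_
  rw [diag_apply, mul_apply, Complex.re_sum]
  refine Finset.sum_congr rfl fun j _ => ?_
  rw [diagonal_mul, diagonal_mul]
  have : (RCLike.ofReal ∘ f ∘ hP.eigenvalues) i * W i j *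
      ((RCLike.ofReal ∘ g ∘ hQ.eigenvalues) j * star W j i) =
      ((f (hP.eigenvalues i) * g (hQ.eigenvalues j) * ‖W i j‖ ^ 2 : ℝ) : ℂ) := by
    have h2 : W i j * star W j i = ((‖W i j‖ ^ 2 : ℝ) : ℂ) := by
      rw [star_apply, ← starRingEnd_apply, Complex.mul_conj, Complex.normSq_eq_norm_sq]
    push_cast at h2 ⊢
    rw [← h2]
    simp only [Function.comp_apply, Complex.coe_algebraMap]
    change ((f (hP.eigenvalues i) : ℂ)) * _ * ((g (hQ.eigenvalues j) : ℂ) * _) = _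
    ring
  rw [this, Complex.ofReal_re]

lemma PosDef.rpow_eq_cfc {P : Matrix ι ι ℂ} (hP : P.PosDef) (r : ℝ) :
    P ^ r = cfc (fun x : ℝ => x ^ r) P :=
  CFC.rpow_eq_cfc_real (by exact hP.posSemidef.nonneg)

/-- Bernoulli's inequality for `(1 + s) ^ t` with `s = x / y - 1`, scaled by `y ^ t`; its strictness
for `s ≠ 0` gives the equality case. -/
lemma rpow_le_tangent {t : ℝ} (ht : t ∈ Set.Ioo (0 : ℝ) 1) {x y : ℝ} (hx : 0 < x) (hy : 0 < y) :
    x ^ t ≤ y ^ t + t * (y ^ (t - 1) * x - y ^ t) ∧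
      (x ^ t = y ^ t + t * (y ^ (t - 1) * x - y ^ t) → x = y) := by
  have hyt : 0 < y ^ t := Real.rpow_pos_of_pos hy t
  have e1 : x ^ t = y ^ t * (1 + (x / y - 1)) ^ t := by
    rw [add_sub_cancel, Real.div_rpow hx.le hy.le]; field_simp
  have e2 : y ^ t + t * (y ^ (t - 1) * x - y ^ t) = y ^ t * (1 + t * (x / y - 1)) := by
    rw [Real.rpow_sub_one hy.ne']; field_simp
  have hs : -1 ≤ x / y - 1 := by have := div_pos hx hy; linarith
  rw [e1, e2]
  by_cases h : x = y
  · subst h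
    simp [div_self hx.ne']
  · have hne : x / y - 1 ≠ 0 := by
      rw [sub_ne_zero, Ne, div_eq_one_iff_eq hy.ne']; exact h
    have := rpow_one_add_lt_one_add_mul_self hs hne ht.1 ht.2
    have := mul_lt_mul_of_pos_left this hyt
    exact ⟨this.le, fun h' => absurd h' this.ne⟩

/-- Klein's inequality for the concave function `x ↦ x ^ t`, with its equality case. -/
lemma trace_rpow_le_tangent {t : ℝ} (ht : t ∈ Set.Ioo (0 : ℝ) 1) {P Q : Matrix ι ι ℂ}
    (hP : P.PosDef) (hQ : Q.PosDef) :
    (P ^ t).trace.re ≤ (Q ^ t).trace.re + t * (Q ^ (t - 1) * (P - Q)).trace.re ∧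
      ((P ^ t).trace.re = (Q ^ t).trace.re + t * (Q ^ (t - 1) * (P - Q)).trace.re → P = Q) := by
  have hPs : IsSelfAdjoint P := hP.isHermitian
  have hQs : IsSelfAdjoint Q := hQ.isHermitian
  set W := star (hP.isHermitian.eigenvectorUnitary : Matrix ι ι ℂ) *
    hQ.isHermitian.eigenvectorUnitary
  set p := hP.isHermitian.eigenvalues
  set q := hQ.isHermitian.eigenvalues
  have hp : ∀ i, 0 < p i := hP.eigenvalues_pos
  have hq : ∀ i, 0 < q i := hQ.eigenvalues_pos
  have key := trace_cfc_mul_cfc hP.isHermitian hQ.isHermitian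
  -- Pairing with the constant function `1` writes every trace as a double sum with the same weights
  -- `‖W i j‖ ^ 2`, so the scalar inequality applies termwise.
  have h1 : (P ^ t).trace.re = ∑ i, ∑ j, p i ^ t * ‖W i j‖ ^ 2 := by
    have := key (fun x => x ^ t) (fun _ => 1)
    rw [cfc_const_one ℝ Q, mul_one, ← PosDef.rpow_eq_cfc hP] at this
    simpa using this
  have h2 : (Q ^ t).trace.re = ∑ i, ∑ j, q j ^ t * ‖W i j‖ ^ 2 := by
    have := key (fun _ => 1) (fun x => x ^ t)
    rw [cfc_const_one ℝ P, one_mul, ← PosDef.rpow_eq_cfc hQ] at this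
    simpa using this
  have h3 : (Q ^ (t - 1) * P).trace.re = ∑ i, ∑ j, q j ^ (t - 1) * p i * ‖W i j‖ ^ 2 := by
    have := key id (fun x => x ^ (t - 1))
    rw [cfc_id ℝ P, ← PosDef.rpow_eq_cfc hQ, trace_mul_comm] at this
    rw [this]
    simp [p, q, W, mul_comm]
  have h4 : Q ^ (t - 1) * Q = Q ^ t := by
    nth_rw 2 [← CFC.rpow_one Q hQ.posSemidef.nonneg]
    rw [← CFC.rpow_add hQ.isUnit, sub_add_cancel]
  have hsum : (Q ^ t).trace.re + t * (Q ^ (t - 1) * (P - Q)).trace.re - (P ^ t).trace.re =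
      ∑ i, ∑ j, (q j ^ t + t * (q j ^ (t - 1) * p i - q j ^ t) - p i ^ t) * ‖W i j‖ ^ 2 := by
    rw [mul_sub, h4, trace_sub, Complex.sub_re, h1, h2, h3]
    simp only [← Finset.sum_sub_distrib, Finset.mul_sum, ← Finset.sum_add_distrib]
    refine Finset.sum_congr rfl fun i _ => Finset.sum_congr rfl fun j _ => ?_
    ring
  have hnn : ∀ i j,
      0 ≤ (q j ^ t + t * (q j ^ (t - 1) * p i - q j ^ t) - p i ^ t) * ‖W i j‖ ^ 2 := fun i j =>
    mul_nonneg (sub_nonneg.2 (rpow_le_tangent ht (hp i) (hq j)).1) (by positivity)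
  constructor
  · rw [← sub_nonneg, hsum]
    exact Finset.sum_nonneg fun i _ => Finset.sum_nonneg fun j _ => hnn i j
  · intro h
    rw [h, sub_self, eq_comm,
      Finset.sum_eq_zero_iff_of_nonneg fun i _ => Finset.sum_nonneg fun j _ => hnn i j] at hsum
    -- In the equality case, eigenvectors with nonzero overlap have equal eigenvalues. The sum of
    -- these terms is `tr (P - Q) ^ 2`, which therefore vanishes.
    have hz : ∀ i j, (p i - q j) ^ 2 * ‖W i j‖ ^ 2 = 0 := by
      intro i j
      have := (Finset.sum_eq_zero_iff_of_nonneg fun j _ => hnn i j).1 (hsum i (Finset.mem_univ _)) j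
        (Finset.mem_univ _)
      rcases mul_eq_zero.1 this with h' | h'
      · rw [(rpow_le_tangent ht (hp i) (hq j)).2 (sub_eq_zero.1 h').symm]; simp
      · rw [h', mul_zero]
    have e1 : (P * P).trace.re = ∑ i, ∑ j, p i ^ 2 * ‖W i j‖ ^ 2 := by
      have := key (fun x => x ^ 2) (fun _ => 1)
      rw [cfc_const_one ℝ Q, mul_one, cfc_pow_id (R := ℝ) P 2, sq] at this
      simpa using this
    have e2 : (Q * Q).trace.re = ∑ i, ∑ j, q j ^ 2 * ‖W i j‖ ^ 2 := by
      have := key (fun _ => 1) (fun x => x ^ 2)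
      rw [cfc_const_one ℝ P, one_mul, cfc_pow_id (R := ℝ) Q 2, sq] at this
      simpa using this
    have e3 : (P * Q).trace.re = ∑ i, ∑ j, p i * q j * ‖W i j‖ ^ 2 := by
      have := key id id
      rwa [cfc_id ℝ P, cfc_id ℝ Q] at this
    have e4 : ((P - Q)ᴴ * (P - Q)).trace.re = 0 := by
      rw [(hP.isHermitian.sub hQ.isHermitian).eq, sub_mul, mul_sub, mul_sub, trace_sub, trace_sub,
        trace_sub, trace_mul_comm Q P]
      simp only [Complex.sub_re, e1, e2, e3, ← Finset.sum_sub_distrib]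
      refine Finset.sum_eq_zero fun i _ => Finset.sum_eq_zero fun j _ => ?_
      linear_combination hz i j
    have e5 : ((P - Q)ᴴ * (P - Q)).trace = 0 := by
      have := (posSemidef_conjTranspose_mul_self (P - Q)).trace_nonneg
      exact Complex.ext e4 (Complex.nonneg_iff.1 this).2.symm
    exact sub_eq_zero.1 (trace_conjTranspose_mul_self_eq_zero_iff.1 e5)

/-! ### Powers of positive definite matrices -/

/-- The functional calculus respects intertwining relations. -/
lemma cfc_mul_of_mul_eq_mul {P Q M : Matrix ι ι ℂ} (hP : P.IsHermitian) (hQ : Q.IsHermitian)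
    (h : P * M = M * Q) (f : ℝ → ℝ) : cfc f P * M = M * cfc f Q := by
  have hPs : IsSelfAdjoint P := hP
  have hQs : IsSelfAdjoint Q := hQ
  classical
  -- One polynomial interpolating `f` on both spectra represents `cfc f P` and `cfc f Q` at once,
  -- and polynomials respect the intertwining.
  let S : Finset ℝ := Finset.univ.image hP.eigenvalues ∪ Finset.univ.image hQ.eigenvalues
  let p := Lagrange.interpolate S id f
  have hp : ∀ x ∈ S, f x = p.eval x := fun x hx =>
    (Lagrange.eval_interpolate_at_node f Function.injective_id.injOn hx).symm
  have eP : cfc f P = Polynomial.aeval P p := by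
    rw [← cfc_polynomial p P]
    refine cfc_congr fun x hx => hp x ?_
    rw [hP.spectrum_real_eq_range_eigenvalues] at hx
    obtain ⟨i, rfl⟩ := hx
    simp [S]
  have eQ : cfc f Q = Polynomial.aeval Q p := by
    rw [← cfc_polynomial p Q]
    refine cfc_congr fun x hx => hp x ?_
    rw [hQ.spectrum_real_eq_range_eigenvalues] at hx
    obtain ⟨i, rfl⟩ := hx
    simp [S]
  rw [eP, eQ]
  induction p using Polynomial.induction_on' with
  | add p q hp hq => simp [add_mul, mul_add, hp, hq]
  | monomial n a =>
    have hn : P ^ n * M = M * Q ^ n := by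
      induction n with
      | zero => simp
      | succ n ih => rw [pow_succ, mul_assoc, h, ← mul_assoc, ih, mul_assoc, ← pow_succ]
    simp [Polynomial.aeval_monomial, ← Algebra.smul_def, hn]

lemma PosDef.rpow {P : Matrix ι ι ℂ} (hP : P.PosDef) (r : ℝ) : (P ^ r).PosDef :=
  isStrictlyPositive_iff_posDef.1 (IsStrictlyPositive.rpow P r hP.isStrictlyPositive)

lemma PosDef.rpow_mul_rpow {P : Matrix ι ι ℂ} (hP : P.PosDef) (r q : ℝ) :
    P ^ r * P ^ q = P ^ (r + q) :=
  (CFC.rpow_add hP.isUnit).symm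

lemma PosDef.rpow_rpow {P : Matrix ι ι ℂ} (hP : P.PosDef) (r q : ℝ) :
    (P ^ r) ^ q = P ^ (r * q) := by
  rcases eq_or_ne r 0 with rfl | hr
  · rw [CFC.rpow_zero P hP.posSemidef.nonneg, zero_mul, CFC.rpow_zero P hP.posSemidef.nonneg,
      CFC.one_rpow]
  · exact CFC.rpow_rpow P r q hr (ha := hP.isStrictlyPositive)

lemma PosDef.smul_rpow {P : Matrix ι ι ℂ} (hP : P.PosDef) {c : ℝ} (hc : 0 < c) (r : ℝ) :
    (c • P) ^ r = c ^ r • P ^ r := by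
  have hPs : IsSelfAdjoint P := hP.isHermitian
  have hcP : (c • P).PosDef := hP.smul hc
  have hpos : ∀ x ∈ spectrum ℝ P, 0 < x := by
    intro x hx
    rw [hP.isHermitian.spectrum_real_eq_range_eigenvalues] at hx
    obtain ⟨i, rfl⟩ := hx
    exact hP.eigenvalues_pos i
  rw [PosDef.rpow_eq_cfc hcP, PosDef.rpow_eq_cfc hP, ← cfc_comp_smul c (fun x : ℝ => x ^ r) P
    (hf := ?_), ← cfc_smul (c ^ r) (fun x : ℝ => x ^ r) P (hf := ?_)]
  · refine cfc_congr fun x hx => ?_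
    simp [Real.mul_rpow hc.le (hpos x hx).le]
  · exact fun x hx => (Real.continuousAt_rpow_const x r (Or.inl (hpos x hx).ne')).continuousWithinAt
  · rintro _ ⟨x, hx, rfl⟩
    exact (Real.continuousAt_rpow_const _ r
      (Or.inl (mul_pos hc (hpos x hx)).ne')).continuousWithinAt

/-- Löwner–Heinz for the exponent `1 - t`, followed by order-reversing inversion. -/
lemma PosDef.rpow_le_rpow_of_neg {t : ℝ} (ht : t ∈ Set.Ioo (0 : ℝ) 1) {P Q : Matrix ι ι ℂ}
    (hP : P.PosDef) (hQ : Q.PosDef) (h : P ≤ Q) : Q ^ (t - 1) ≤ P ^ (t - 1) := by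
  have h1 : P ^ (1 - t) ≤ Q ^ (1 - t) :=
    CFC.rpow_le_rpow ⟨by linarith [ht.2], by linarith [ht.1]⟩ h
  have h2 := CStarAlgebra.rpow_neg_one_le_rpow_neg_one h1
    (PosDef.rpow hP _).isStrictlyPositive
  rw [PosDef.rpow_rpow hP, PosDef.rpow_rpow hQ] at h2
  convert h2 using 2 <;> ring

/-- By cyclicity `tr (M * N)` is the trace of `√N * M * √N`, which is monotone in `M`. -/
lemma re_trace_mul_le {P Q N : Matrix ι ι ℂ} (h : P ≤ Q) (hN : 0 ≤ N) :
    (P * N).trace.re ≤ (Q * N).trace.re := by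
  have hs : IsSelfAdjoint (CFC.sqrt N) := (CFC.sqrt_nonneg N).isSelfAdjoint
  have h1 : CFC.sqrt N * P * CFC.sqrt N ≤ CFC.sqrt N * Q * CFC.sqrt N :=
    hs.conjugate_le_conjugate h
  have h2 := (le_iff.1 h1).trace_nonneg
  have e : ∀ M : Matrix ι ι ℂ, (CFC.sqrt N * M * CFC.sqrt N).trace = (M * N).trace := by
    intro M
    rw [trace_mul_comm, ← mul_assoc, CFC.sqrt_mul_sqrt_self N, trace_mul_comm]
  rw [trace_sub, e, e] at h2
  have := (Complex.nonneg_iff.1 h2).1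
  rw [Complex.sub_re] at this
  linarith

lemma re_trace_cfc {P : Matrix ι ι ℂ} (hP : P.IsHermitian) (f : ℝ → ℝ) :
    (cfc f P).trace.re = ∑ i, f (hP.eigenvalues i) := by
  rw [hP.cfc_eq, IsHermitian.cfc, Unitary.conjStarAlgAut_apply, mul_assoc, trace_mul_comm,
    mul_assoc, Unitary.coe_star_mul_self, mul_one, trace_diagonal, Complex.re_sum]
  rfl

lemma continuousOn_rpow_posDef (r : ℝ) :
    ContinuousOn (fun P : Matrix ι ι ℂ => P ^ r) {P | P.PosDef} := by
  refine ContinuousOn.congr (f := fun P : Matrix ι ι ℂ => cfc (fun x : ℝ => x ^ r) P) ?_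
    fun P hP => PosDef.rpow_eq_cfc hP r
  refine ContinuousOn.cfc_of_mem_nhdsSet (s := Set.Ioi 0) _ ?_ continuousOn_id
    (fun P hP => (hP : P.PosDef).isHermitian) ?_
  · refine isOpen_Ioi.mem_nhdsSet.2 (Set.iUnion₂_subset fun P hP x hx => ?_)
    have hP' : P.PosDef := hP
    change x ∈ spectrum ℝ P at hx
    rw [hP'.isHermitian.spectrum_real_eq_range_eigenvalues] at hx
    obtain ⟨i, rfl⟩ := hx
    exact hP'.eigenvalues_pos i
  · exact fun x hx => (Real.continuousAt_rpow_const x r (Or.inl (ne_of_gt hx))).continuousWithinAt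

/-! ### The gradient terms: monotonicity and bounds -/

/-- The congruence `A ^ s * X * A ^ s` with `s = (1 - t) / (2 * t)`. -/
noncomputable def congr (t : ℝ) (A X : Matrix ι ι ℂ) : Matrix ι ι ℂ :=
  A ^ ((1 - t) / (2 * t)) * X * A ^ ((1 - t) / (2 * t))

/-- `t⁻¹` times the gradient of `X ↦ tr (congr t A X) ^ t`. -/
noncomputable def gradTerm (t : ℝ) (A X : Matrix ι ι ℂ) : Matrix ι ι ℂ :=
  congr t A (congr t A X ^ (t - 1))

lemma congr_posDef (t : ℝ) {A X : Matrix ι ι ℂ} (hA : A.PosDef) (hX : X.PosDef) :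
    (congr t A X).PosDef := by
  have h := PosDef.rpow hA ((1 - t) / (2 * t))
  have := (IsUnit.posDef_star_left_conjugate_iff (x := X) h.isUnit).2 hX
  rwa [star_eq_conjTranspose, h.isHermitian.eq] at this

lemma congr_mono (t : ℝ) {A X Y : Matrix ι ι ℂ} (hA : A.PosDef) (h : X ≤ Y) :
    congr t A X ≤ congr t A Y :=
  IsSelfAdjoint.conjugate_le_conjugate h
    (PosDef.rpow hA ((1 - t) / (2 * t))).isHermitian.isSelfAdjoint

lemma congr_sub (t : ℝ) (A X Y : Matrix ι ι ℂ) :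
    congr t A (X - Y) = congr t A X - congr t A Y := by
  simp [congr, mul_sub, sub_mul]

lemma gradTerm_posDef (t : ℝ) {A X : Matrix ι ι ℂ} (hA : A.PosDef) (hX : X.PosDef) :
    (gradTerm t A X).PosDef :=
  congr_posDef t hA (PosDef.rpow (congr_posDef t hA hX) _)

lemma gradTerm_anti {t : ℝ} (ht : t ∈ Set.Ioo (0 : ℝ) 1) {A X Y : Matrix ι ι ℂ} (hA : A.PosDef)
    (hX : X.PosDef) (hY : Y.PosDef) (h : X ≤ Y) : gradTerm t A Y ≤ gradTerm t A X :=
  congr_mono t hA (PosDef.rpow_le_rpow_of_neg ht (congr_posDef t hA hX) (congr_posDef t hA hY)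
    (congr_mono t hA h))

/-- With `s = (1 - t) / (2 * t)` the exponents add up to `2 * s + 2 * s * (t - 1) = 2 * s * t = 1 -
t`. -/
lemma gradTerm_one {t : ℝ} (ht : t ∈ Set.Ioo (0 : ℝ) 1) {A : Matrix ι ι ℂ} (hA : A.PosDef) :
    gradTerm t A 1 = A ^ (1 - t) := by
  have := ht.1.ne'
  rw [gradTerm, congr, congr, mul_one, PosDef.rpow_mul_rpow hA, PosDef.rpow_rpow hA,
    PosDef.rpow_mul_rpow hA, PosDef.rpow_mul_rpow hA]
  congr 1
  field_simp
  ring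

lemma continuousOn_congr_rpow (t r : ℝ) {A : Matrix ι ι ℂ} (hA : A.PosDef) :
    ContinuousOn (fun X => congr t A X ^ r) {X | X.PosDef} := by
  refine (continuousOn_rpow_posDef r).comp (Continuous.continuousOn ?_)
    fun X hX => congr_posDef t hA hX
  unfold congr
  fun_prop

lemma continuousOn_gradTerm (t : ℝ) {A : Matrix ι ι ℂ} (hA : A.PosDef) :
    ContinuousOn (fun X => gradTerm t A X) {X | X.PosDef} :=
  (continuousOn_const.mul (continuousOn_congr_rpow t (t - 1) hA)).mul continuousOn_const

/-- Conjugating the gradient by `X ^ (1 / 2)` moves the power to the opposite congruence. -/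
lemma conj_sqrt_gradTerm {t : ℝ} (ht : t ∈ Set.Ioo (0 : ℝ) 1) {A X : Matrix ι ι ℂ} (hA : A.PosDef)
    (hX : X.PosDef) :
    X ^ (1 / 2 : ℝ) * gradTerm t A X * X ^ (1 / 2 : ℝ) =
      (X ^ (1 / 2 : ℝ) * A ^ ((1 - t) / t) * X ^ (1 / 2 : ℝ)) ^ t := by
  set s := (1 - t) / (2 * t) with hs
  set R := X ^ (1 / 2 : ℝ) with hR
  have hR0 : R.PosDef := PosDef.rpow hX _
  have hRR : R * R = X := by
    rw [hR, PosDef.rpow_mul_rpow hX, add_halves, CFC.rpow_one X hX.posSemidef.nonneg]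
  have hAA : A ^ s * A ^ s = A ^ ((1 - t) / t) := by
    have := ht.1.ne'
    rw [PosDef.rpow_mul_rpow hA, hs]
    congr 1
    field_simp
    ring
  have hP : (congr t A X).PosDef := congr_posDef t hA hX
  set Q := R * A ^ ((1 - t) / t) * R with hQdef
  have hQ : Q.PosDef := by
    have := (IsUnit.posDef_star_left_conjugate_iff (x := A ^ ((1 - t) / t)) hR0.isUnit).2
      (PosDef.rpow hA _)
    rwa [star_eq_conjTranspose, hR0.isHermitian.eq] at this
  -- `A ^ s * R` intertwines the two congruences because `X = R * R`; the functional calculus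
  -- carries this over to the power `t - 1`.
  have hPQ : congr t A X * (A ^ s * R) = (A ^ s * R) * Q := by
    rw [hQdef, ← hAA, congr, ← hs, ← hRR]
    simp only [mul_assoc]
  have h := cfc_mul_of_mul_eq_mul hP.isHermitian hQ.isHermitian hPQ (fun x => x ^ (t - 1))
  rw [← PosDef.rpow_eq_cfc hP, ← PosDef.rpow_eq_cfc hQ] at h
  calc R * gradTerm t A X * R = R * A ^ s * (congr t A X ^ (t - 1) * (A ^ s * R)) := by
        rw [gradTerm]
        nth_rw 1 [congr]
        rw [← hs]
        simp only [mul_assoc]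
    _ = Q * Q ^ (t - 1) := by
        rw [h, hQdef, ← hAA]
        simp only [mul_assoc]
    _ = Q ^ t := by
        nth_rw 1 [← CFC.rpow_one Q hQ.posSemidef.nonneg]
        rw [PosDef.rpow_mul_rpow hQ, add_sub_cancel]

lemma le_of_conj_sqrt_le {X M N : Matrix ι ι ℂ} (hX : X.PosDef)
    (h : X ^ (1 / 2 : ℝ) * M * X ^ (1 / 2 : ℝ) ≤ X ^ (1 / 2 : ℝ) * N * X ^ (1 / 2 : ℝ)) :
    M ≤ N := by
  have h1 := IsSelfAdjoint.conjugate_le_conjugate h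
    (PosDef.rpow hX (-(1 / 2))).isHermitian.isSelfAdjoint
  have e1 : X ^ (-(1 / 2) : ℝ) * X ^ (1 / 2 : ℝ) = 1 := by
    rw [PosDef.rpow_mul_rpow hX, neg_add_cancel, CFC.rpow_zero X hX.posSemidef.nonneg]
  have e2 : X ^ (1 / 2 : ℝ) * X ^ (-(1 / 2) : ℝ) = 1 := by
    rw [PosDef.rpow_mul_rpow hX, add_neg_cancel, CFC.rpow_zero X hX.posSemidef.nonneg]
  have e3 : ∀ B : Matrix ι ι ℂ, X ^ (-(1 / 2) : ℝ) * (X ^ (1 / 2 : ℝ) * B * X ^ (1 / 2 : ℝ)) *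
      X ^ (-(1 / 2) : ℝ) = B := by
    intro B
    rw [mul_assoc, mul_assoc _ _ (X ^ (-(1 / 2) : ℝ)), e2, mul_one, ← mul_assoc, e1, one_mul]
  rwa [e3, e3] at h1

lemma conj_sqrt_smul_rpow {X : Matrix ι ι ℂ} (hX : X.PosDef) (c t : ℝ) :
    X ^ (1 / 2 : ℝ) * (c • X ^ (t - 1)) * X ^ (1 / 2 : ℝ) = c • X ^ t := by
  rw [mul_smul_comm, smul_mul_assoc, PosDef.rpow_mul_rpow hX, PosDef.rpow_mul_rpow hX]
  congr 2
  ring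

lemma smul_conj_sqrt_rpow {t : ℝ} (ht : t ∈ Set.Ioo (0 : ℝ) 1) {X : Matrix ι ι ℂ} (hX : X.PosDef)
    {c : ℝ} (hc : 0 < c) :
    (X ^ (1 / 2 : ℝ) * algebraMap ℝ _ (c ^ ((1 - t) / t)) * X ^ (1 / 2 : ℝ)) ^ t =
      c ^ (1 - t) • X ^ t := by
  rw [Algebra.algebraMap_eq_smul_one, mul_smul_comm, smul_mul_assoc, mul_one,
    PosDef.rpow_mul_rpow hX, add_halves, CFC.rpow_one X hX.posSemidef.nonneg,
    PosDef.smul_rpow hX (Real.rpow_pos_of_pos hc _), ← Real.rpow_mul hc.le,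
    div_mul_cancel₀ _ ht.1.ne']

/-- After conjugation by `X ^ (1 / 2)` both sides are `t`-th powers, and Löwner–Heinz applies to the
outer power. The inner exponent `(1 - t) / t` may exceed `1`, where operator monotonicity fails, but
comparison with a scalar only needs the spectrum. -/
lemma smul_rpow_le_gradTerm {t : ℝ} (ht : t ∈ Set.Ioo (0 : ℝ) 1) {A X : Matrix ι ι ℂ}
    (hA : A.PosDef) (hX : X.PosDef) {c : ℝ} (hc : 0 < c) (h : algebraMap ℝ _ c ≤ A) :
    c ^ (1 - t) • X ^ (t - 1) ≤ gradTerm t A X := by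
  have hAs : IsSelfAdjoint A := hA.isHermitian
  have hr : 0 ≤ (1 - t) / t := div_nonneg (by linarith [ht.2]) ht.1.le
  have h1 : algebraMap ℝ _ (c ^ ((1 - t) / t)) ≤ A ^ ((1 - t) / t) := by
    rw [PosDef.rpow_eq_cfc hA]
    rw [algebraMap_le_iff_le_spectrum] at h
    refine algebraMap_le_cfc _ _ _ (fun x hx => Real.rpow_le_rpow hc.le (h x hx) hr) ?_
    exact (Real.continuous_rpow_const hr).continuousOn
  apply le_of_conj_sqrt_le hX
  rw [conj_sqrt_smul_rpow hX, conj_sqrt_gradTerm ht hA hX, ← smul_conj_sqrt_rpow ht hX hc]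
  exact CFC.rpow_le_rpow ⟨ht.1.le, ht.2.le⟩ (IsSelfAdjoint.conjugate_le_conjugate h1
    (PosDef.rpow hX _).isHermitian.isSelfAdjoint)

lemma gradTerm_le_smul_rpow {t : ℝ} (ht : t ∈ Set.Ioo (0 : ℝ) 1) {A X : Matrix ι ι ℂ}
    (hA : A.PosDef) (hX : X.PosDef) {c : ℝ} (hc : 0 < c) (h : A ≤ algebraMap ℝ _ c) :
    gradTerm t A X ≤ c ^ (1 - t) • X ^ (t - 1) := by
  have hAs : IsSelfAdjoint A := hA.isHermitian
  have hr : 0 ≤ (1 - t) / t := div_nonneg (by linarith [ht.2]) ht.1.le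
  have h1 : A ^ ((1 - t) / t) ≤ algebraMap ℝ _ (c ^ ((1 - t) / t)) := by
    rw [PosDef.rpow_eq_cfc hA]
    rw [le_algebraMap_iff_spectrum_le] at h
    refine cfc_le_algebraMap _ _ _ (fun x hx => Real.rpow_le_rpow ?_ (h x hx) hr) ?_
    · rw [hA.isHermitian.spectrum_real_eq_range_eigenvalues] at hx
      obtain ⟨i, rfl⟩ := hx
      exact (hA.eigenvalues_pos i).le
    · exact (Real.continuous_rpow_const hr).continuousOn
  apply le_of_conj_sqrt_le hX
  rw [conj_sqrt_smul_rpow hX, conj_sqrt_gradTerm ht hA hX, ← smul_conj_sqrt_rpow ht hX hc]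
  exact CFC.rpow_le_rpow ⟨ht.1.le, ht.2.le⟩ (IsSelfAdjoint.conjugate_le_conjugate h1
    (PosDef.rpow hX _).isHermitian.isSelfAdjoint)

/-! ### Convexity and the first order conditions -/

/-- The weighted sum of the gradient terms; `t • (1 - grad t w A X)` is the gradient of
`objective t w A` at `X`. -/
noncomputable def grad {m n : ℕ} (t : ℝ) (w : Fin n → ℝ) (A : Fin n → Matrix (Fin m) (Fin m) ℂ)
    (X : Matrix (Fin m) (Fin m) ℂ) : Matrix (Fin m) (Fin m) ℂ :=
  ∑ j, w j • gradTerm t (A j) X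

variable {m n : ℕ} {t : ℝ} {w : Fin n → ℝ} {A : Fin n → Matrix (Fin m) (Fin m) ℂ}

lemma grad_isHermitian (hA : ∀ j, (A j).PosDef) {X : Matrix (Fin m) (Fin m) ℂ} (hX : X.PosDef) :
    (grad t w A X).IsHermitian := by
  have : IsSelfAdjoint (grad t w A X) := isSelfAdjoint_sum _ fun j _ =>
    (IsSelfAdjoint.all (w j)).smul (gradTerm_posDef t (hA j) hX).isHermitian.isSelfAdjoint
  exact this

lemma continuousOn_grad (hA : ∀ j, (A j).PosDef) :
    ContinuousOn (grad t w A) {X | X.PosDef} :=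
  continuousOn_finsetSum _ fun j _ => (continuousOn_gradTerm t (hA j)).const_smul (w j)

lemma continuousOn_objective (hA : ∀ j, (A j).PosDef) :
    ContinuousOn (objective t w A) {X | X.PosDef} := by
  have htr : Continuous fun X : Matrix (Fin m) (Fin m) ℂ => X.trace.re :=
    Complex.continuous_re.comp continuous_id.matrix_trace
  refine continuousOn_finsetSum _ fun j _ => continuousOn_const.mul (ContinuousOn.sub ?_ ?_)
  · exact (htr.comp (by fun_prop)).continuousOn
  · exact htr.comp_continuousOn (continuousOn_congr_rpow t t (hA j))

lemma trace_gradTerm_mul (t : ℝ) (B X M : Matrix (Fin m) (Fin m) ℂ) :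
    (gradTerm t B X * M).trace = (congr t B X ^ (t - 1) * congr t B M).trace := by
  rw [gradTerm]
  nth_rw 1 [congr]
  nth_rw 3 [congr]
  rw [mul_assoc, mul_assoc, trace_mul_comm]
  simp only [mul_assoc]

/-- The objective function lies above its tangents, and touches them only at the base point. -/
lemma objective_tangent_le (ht : t ∈ Set.Ioo (0 : ℝ) 1) (hw : w ∈ stdSimplex ℝ (Fin n))
    (hA : ∀ j, (A j).PosDef) {X Y : Matrix (Fin m) (Fin m) ℂ} (hX : X.PosDef) (hY : Y.PosDef) :
    objective t w A X + t * ((1 - grad t w A X) * (Y - X)).trace.re ≤ objective t w A Y ∧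
      (objective t w A X + t * ((1 - grad t w A X) * (Y - X)).trace.re = objective t w A Y →
        Y = X) := by
  have hk := fun j => trace_rpow_le_tangent ht (congr_posDef t (hA j) hY)
    (congr_posDef t (hA j) hX)
  set gap : Fin n → ℝ := fun j => (congr t (A j) X ^ t).trace.re +
    t * (congr t (A j) X ^ (t - 1) * (congr t (A j) Y - congr t (A j) X)).trace.re -
      (congr t (A j) Y ^ t).trace.re with hgap
  have hobj : objective t w A Y -
      (objective t w A X + t * ((1 - grad t w A X) * (Y - X)).trace.re) = ∑ j, w j * gap j := by
    have h1 : ((1 - grad t w A X) * (Y - X)).trace.re = ∑ j, w j * ((Y - X).trace.re -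
        (congr t (A j) X ^ (t - 1) * (congr t (A j) Y - congr t (A j) X)).trace.re) := by
      have h2 : (grad t w A X * (Y - X)).trace.re = ∑ j, w j *
          (congr t (A j) X ^ (t - 1) * (congr t (A j) Y - congr t (A j) X)).trace.re := by
        rw [grad, Finset.sum_mul, trace_sum, Complex.re_sum]
        refine Finset.sum_congr rfl fun j _ => ?_
        rw [smul_mul_assoc, trace_smul, Complex.smul_re, trace_gradTerm_mul, congr_sub,
          smul_eq_mul]
      simp only [mul_sub (w _), Finset.sum_sub_distrib]
      rw [← Finset.sum_mul, hw.2, one_mul, ← h2, sub_mul, one_mul, trace_sub, Complex.sub_re]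
    rw [h1, objective, objective, Finset.mul_sum, ← Finset.sum_add_distrib,
      ← Finset.sum_sub_distrib]
    refine Finset.sum_congr rfl fun j _ => ?_
    simp only [trace_add, trace_smul, trace_sub, Complex.add_re, Complex.sub_re, Complex.smul_re,
      smul_eq_mul, hgap]
    simp only [congr]
    ring
  have hg : ∀ j, 0 ≤ w j * gap j := fun j => mul_nonneg (hw.1 j) (sub_nonneg.2 (hk j).1)
  constructor
  · rw [← sub_nonneg, hobj]
    exact Finset.sum_nonneg fun j _ => hg j
  · intro h
    rw [h, sub_self, eq_comm, Finset.sum_eq_zero_iff_of_nonneg fun j _ => hg j] at hobj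
    obtain ⟨j, hj⟩ : ∃ j, w j ≠ 0 := by
      by_contra! h0
      have := hw.2
      simp [h0] at this
    have h3 := (hk j).2
      (sub_eq_zero.1 ((mul_eq_zero.1 (hobj j (Finset.mem_univ j))).resolve_left hj)).symm
    have hU := (PosDef.rpow (hA j) ((1 - t) / (2 * t))).isUnit
    exact hU.mul_left_cancel (hU.mul_right_cancel h3)

lemma isMinimizer_of_grad_eq_one (ht : t ∈ Set.Ioo (0 : ℝ) 1) (hw : w ∈ stdSimplex ℝ (Fin n))
    (hA : ∀ j, (A j).PosDef) {X : Matrix (Fin m) (Fin m) ℂ} (hX : X.PosDef)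
    (h : grad t w A X = 1) : IsMinimizer t w A X :=
  ⟨hX, fun Y hY => by simpa [h] using (objective_tangent_le ht hw hA hX hY).1⟩

lemma eq_of_grad_eq_one (ht : t ∈ Set.Ioo (0 : ℝ) 1) (hw : w ∈ stdSimplex ℝ (Fin n))
    (hA : ∀ j, (A j).PosDef) {X Y : Matrix (Fin m) (Fin m) ℂ} (hX : X.PosDef)
    (h : grad t w A X = 1) (hY : IsMinimizer t w A Y) : Y = X := by
  have h1 := objective_tangent_le ht hw hA hX hY.1
  refine h1.2 (le_antisymm h1.1 ?_)
  simpa [h] using hY.2 X hX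

/-- The first order condition at a minimizer over a convex set. -/
lemma re_trace_one_sub_grad_nonneg (ht : t ∈ Set.Ioo (0 : ℝ) 1) (hw : w ∈ stdSimplex ℝ (Fin n))
    (hA : ∀ j, (A j).PosDef) {K : Set (Matrix (Fin m) (Fin m) ℂ)} (hK : Convex ℝ K)
    (hKpos : ∀ X ∈ K, X.PosDef) {X Y : Matrix (Fin m) (Fin m) ℂ} (hX : X ∈ K) (hY : Y ∈ K)
    (hmin : IsMinOn (objective t w A) K X) :
    0 ≤ ((1 - grad t w A X) * (Y - X)).trace.re := by
  have hmem : ∀ ε ∈ Set.Ioo (0 : ℝ) 1, X + ε • (Y - X) ∈ K := fun ε hε =>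
    hK.add_smul_sub_mem hX hY ⟨hε.1.le, hε.2.le⟩
  have hIoo : ∀ᶠ ε in 𝓝[>] (0 : ℝ), ε ∈ Set.Ioo (0 : ℝ) 1 := Ioo_mem_nhdsGT one_pos
  have hlim : Tendsto (fun ε : ℝ => X + ε • (Y - X)) (𝓝[>] 0) (𝓝[{X | X.PosDef}] X) := by
    refine tendsto_nhdsWithin_iff.2 ⟨?_, hIoo.mono fun ε hε => hKpos _ (hmem ε hε)⟩
    have : Continuous fun ε : ℝ => X + ε • (Y - X) := by fun_prop
    simpa using (this.tendsto 0).mono_left nhdsWithin_le_nhds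
  have hlim2 : Tendsto (fun ε : ℝ => ((1 - grad t w A (X + ε • (Y - X))) * (Y - X)).trace.re)
      (𝓝[>] 0) (𝓝 ((1 - grad t w A X) * (Y - X)).trace.re) := by
    have hc : Continuous fun G : Matrix (Fin m) (Fin m) ℂ => ((1 - G) * (Y - X)).trace.re :=
      Complex.continuous_re.comp (Continuous.matrix_trace (by fun_prop))
    exact (hc.tendsto _).comp (((continuousOn_grad hA) X (hKpos X hX)).tendsto.comp hlim)
  refine ge_of_tendsto hlim2 (hIoo.mono fun ε hε => ?_)
  -- The tangent is taken at the displaced point and evaluated at `X`: with minimality this gives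
  -- the sign of the slope there, so continuity of `grad` replaces differentiation.
  have h1 := (objective_tangent_le ht hw hA (hKpos _ (hmem ε hε)) (hKpos X hX)).1
  have h2 : objective t w A X ≤ objective t w A (X + ε • (Y - X)) := hmin (hmem ε hε)
  have h3 : X - (X + ε • (Y - X)) = -(ε • (Y - X)) := by abel
  rw [h3, mul_neg, trace_neg, Complex.neg_re, mul_smul_comm, trace_smul, Complex.smul_re,
    smul_eq_mul] at h1
  have h4 : 0 ≤ t * (ε * ((1 - grad t w A (X + ε • (Y - X))) * (Y - X)).trace.re) := by linarith
  exact nonneg_of_mul_nonneg_right (nonneg_of_mul_nonneg_right h4 ht.1) hε.1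

/-! ### Existence of a critical point -/

lemma sum_smul_le_sum_smul (hw : w ∈ stdSimplex ℝ (Fin n))
    {B C : Fin n → Matrix (Fin m) (Fin m) ℂ} (h : ∀ j, B j ≤ C j) :
    ∑ j, w j • B j ≤ ∑ j, w j • C j :=
  Finset.sum_le_sum fun j _ => by
    rw [le_iff, ← smul_sub]
    exact (le_iff.1 (h j)).smul (hw.1 j)

lemma sum_smul_const (hw : w ∈ stdSimplex ℝ (Fin n)) (B : Matrix (Fin m) (Fin m) ℂ) :
    ∑ j, w j • B = B := by
  rw [← Finset.sum_smul, hw.2, one_smul]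

lemma smul_rpow_le_grad (ht : t ∈ Set.Ioo (0 : ℝ) 1) (hw : w ∈ stdSimplex ℝ (Fin n))
    (hA : ∀ j, (A j).PosDef) {X : Matrix (Fin m) (Fin m) ℂ} (hX : X.PosDef) {c : ℝ} (hc : 0 < c)
    (h : ∀ j, algebraMap ℝ _ c ≤ A j) : c ^ (1 - t) • X ^ (t - 1) ≤ grad t w A X := by
  rw [← sum_smul_const hw (c ^ (1 - t) • X ^ (t - 1))]
  exact sum_smul_le_sum_smul hw fun j => smul_rpow_le_gradTerm ht (hA j) hX hc (h j)

lemma grad_le_smul_rpow (ht : t ∈ Set.Ioo (0 : ℝ) 1) (hw : w ∈ stdSimplex ℝ (Fin n))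
    (hA : ∀ j, (A j).PosDef) {X : Matrix (Fin m) (Fin m) ℂ} (hX : X.PosDef) {c : ℝ} (hc : 0 < c)
    (h : ∀ j, A j ≤ algebraMap ℝ _ c) : grad t w A X ≤ c ^ (1 - t) • X ^ (t - 1) := by
  rw [← sum_smul_const hw (c ^ (1 - t) • X ^ (t - 1))]
  exact sum_smul_le_sum_smul hw fun j => gradTerm_le_smul_rpow ht (hA j) hX hc (h j)

lemma posDef_of_algebraMap_le {X : Matrix (Fin m) (Fin m) ℂ} {a : ℝ} (ha : 0 < a)
    (h : algebraMap ℝ _ a ≤ X) : X.PosDef := by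
  have h1 : (algebraMap ℝ (Matrix (Fin m) (Fin m) ℂ) a).PosDef := by
    rw [Algebra.algebraMap_eq_smul_one]
    exact PosDef.one.smul ha
  simpa using h1.add_posSemidef (le_iff.1 h)

lemma exists_algebraMap_bounds (hA : ∀ j, (A j).PosDef) :
    ∃ a b : ℝ, 0 < a ∧ a ≤ b ∧ ∀ j, algebraMap ℝ _ a ≤ A j ∧ A j ≤ algebraMap ℝ _ b := by
  have hmono : ∀ r s : ℝ, r ≤ s →
      algebraMap ℝ (Matrix (Fin m) (Fin m) ℂ) r ≤ algebraMap ℝ _ s := fun r s h =>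
    algebraMap_mono _ h
  have h1 : ∀ j, ∃ a : ℝ, 0 < a ∧ algebraMap ℝ _ a ≤ A j := by
    intro j
    rcases isEmpty_or_nonempty (Fin m) with h | h
    -- For `m = 0` all matrices coincide, so any positive constant works.
    · exact ⟨1, one_pos, (Subsingleton.elim _ _).le⟩
    · exact (CFC.exists_pos_algebraMap_le_iff (hA j).isHermitian.isSelfAdjoint).2 fun x hx => by
        rw [(hA j).isHermitian.spectrum_real_eq_range_eigenvalues] at hx
        obtain ⟨i, rfl⟩ := hx
        exact (hA j).eigenvalues_pos i
  choose a ha ha' using h1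
  obtain ⟨a₀, ha₀, hle⟩ : ∃ a₀ : ℝ, 0 < a₀ ∧ ∀ j, a₀ ≤ a j := by
    rcases isEmpty_or_nonempty (Fin n) with h | h
    · exact ⟨1, one_pos, fun j => h.elim j⟩
    · obtain ⟨j, hj⟩ := Finite.exists_min a
      exact ⟨a j, ha j, hj⟩
  refine ⟨a₀, max a₀ (∑ j, ‖A j‖), ha₀, le_max_left _ _, fun j => ⟨(hmono _ _ (hle j)).trans (ha' j),
    ((hA j).isHermitian.isSelfAdjoint.le_algebraMap_norm_self).trans (hmono _ _ ?_)⟩⟩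
  exact (Finset.single_le_sum (f := fun j => ‖A j‖) (fun _ _ => norm_nonneg _)
    (Finset.mem_univ j)).trans (le_max_right _ _)

lemma isCompact_Icc_algebraMap {a b : ℝ} (ha : 0 < a) :
    IsCompact (Set.Icc (algebraMap ℝ (Matrix (Fin m) (Fin m) ℂ) a) (algebraMap ℝ _ b)) := by
  have : ProperSpace (Matrix (Fin m) (Fin m) ℂ) := FiniteDimensional.proper ℂ _
  refine Metric.isCompact_of_isClosed_isBounded isClosed_Icc ?_
  refine (Metric.isBounded_closedBall (x := 0)
    (r := ‖algebraMap ℝ (Matrix (Fin m) (Fin m) ℂ) b‖)).subset fun X hX => ?_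
  rw [mem_closedBall_zero_iff]
  exact CStarAlgebra.norm_le_norm_of_nonneg_of_le
    (posDef_of_algebraMap_le ha hX.1).posSemidef.nonneg hX.2

lemma PosDef.cfc_mul_rpow {X : Matrix (Fin m) (Fin m) ℂ} (hX : X.PosDef) (c r : ℝ) (f : ℝ → ℝ) :
    ((c • X ^ r) * cfc f X).trace.re =
      ∑ i, c * hX.isHermitian.eigenvalues i ^ r * f (hX.isHermitian.eigenvalues i) := by
  have hfin : (spectrum ℝ X).Finite := by
    rw [hX.isHermitian.spectrum_real_eq_range_eigenvalues]
    exact Set.finite_range _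
  have hc : ∀ g : ℝ → ℝ, ContinuousOn g (spectrum ℝ X) := fun g => hfin.continuousOn g
  rw [PosDef.rpow_eq_cfc hX, smul_mul_assoc, ← cfc_mul _ _ X (hc _) (hc _), trace_smul,
    Complex.smul_re, re_trace_cfc hX.isHermitian, smul_eq_mul, Finset.mul_sum]
  simp only [mul_assoc]

lemma algebraMap_le_of_eigenvalues {X : Matrix (Fin m) (Fin m) ℂ} (hX : X.IsHermitian) {a : ℝ}
    (h : ∀ i, a ≤ hX.eigenvalues i) : algebraMap ℝ _ a ≤ X := by
  rw [algebraMap_le_iff_le_spectrum (ha := hX.isSelfAdjoint)]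
  intro x hx
  rw [hX.spectrum_real_eq_range_eigenvalues] at hx
  obtain ⟨i, rfl⟩ := hx
  exact h i

lemma le_algebraMap_of_eigenvalues {X : Matrix (Fin m) (Fin m) ℂ} (hX : X.IsHermitian) {a : ℝ}
    (h : ∀ i, hX.eigenvalues i ≤ a) : X ≤ algebraMap ℝ _ a := by
  rw [le_algebraMap_iff_spectrum_le (ha := hX.isSelfAdjoint)]
  intro x hx
  rw [hX.spectrum_real_eq_range_eigenvalues] at hx
  obtain ⟨i, rfl⟩ := hx
  exact h i

lemma mul_rpow_compare_one {c x : ℝ} (ht : t ∈ Set.Ioo (0 : ℝ) 1) (hc : 0 < c) (hx : 0 < x) :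
    (x < c → 1 < c ^ (1 - t) * x ^ (t - 1)) ∧ (c < x → c ^ (1 - t) * x ^ (t - 1) < 1) := by
  have e : c ^ (1 - t) * x ^ (t - 1) = (c / x) ^ (1 - t) := by
    rw [Real.div_rpow hc.le hx.le, ← neg_sub 1 t, Real.rpow_neg hx.le, div_eq_mul_inv]
  have h1 : 0 < 1 - t := by linarith [ht.2]
  rw [e]
  exact ⟨fun h => Real.one_lt_rpow ((one_lt_div hx).2 h) h1,
    fun h => Real.rpow_lt_one (div_pos hc hx).le ((div_lt_one hx).2 h) h1⟩

/-- Test the first order condition against `X` with its eigenvalues raised to at least `c`. The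
increment `N` satisfies `tr (c ^ (1 - t) • X ^ (t - 1) * N) ≤ tr (grad * N) ≤ tr N`. An eigenvalue
`x < c` has the factor `(c / x) ^ (1 - t) > 1`, so it would make the reverse inequality strict. -/
lemma algebraMap_le_of_isMinOn (ht : t ∈ Set.Ioo (0 : ℝ) 1) (hw : w ∈ stdSimplex ℝ (Fin n))
    (hA : ∀ j, (A j).PosDef) {X : Matrix (Fin m) (Fin m) ℂ} {a b c : ℝ} (ha : 0 < a)
    (hac : a ≤ c) (hcb : c ≤ b) (hc : ∀ j, algebraMap ℝ _ c ≤ A j)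
    (hX : X ∈ Set.Icc (algebraMap ℝ (Matrix (Fin m) (Fin m) ℂ) a) (algebraMap ℝ _ b))
    (hmin : IsMinOn (objective t w A) (Set.Icc (algebraMap ℝ _ a) (algebraMap ℝ _ b)) X) :
    algebraMap ℝ _ c ≤ X := by
  have hXp := posDef_of_algebraMap_le ha hX.1
  have hXs : IsSelfAdjoint X := hXp.isHermitian
  have hsb := (le_algebraMap_iff_spectrum_le (ha := hXs)).1 hX.2
  have hmax : Continuous fun x : ℝ => max c x := by fun_prop
  have hY : cfc (fun x : ℝ => max c x) X ∈
      Set.Icc (algebraMap ℝ (Matrix (Fin m) (Fin m) ℂ) a) (algebraMap ℝ _ b) :=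
    ⟨algebraMap_le_cfc _ _ _ (fun x _ => hac.trans (le_max_left _ _)) hmax.continuousOn hXs,
      cfc_le_algebraMap _ _ _ (fun x hx => max_le hcb (hsb x hx)) hmax.continuousOn hXs⟩
  have hVI := re_trace_one_sub_grad_nonneg ht hw hA (convex_Icc _ _)
    (fun Z hZ => posDef_of_algebraMap_le ha hZ.1) hX hY hmin
  have hN : cfc (fun x : ℝ => max c x) X - X = cfc (fun x : ℝ => max c x - x) X := by
    rw [cfc_sub _ _ X hmax.continuousOn continuous_id'.continuousOn, cfc_id' ℝ X]
  have hN0 : 0 ≤ cfc (fun x : ℝ => max c x - x) X :=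
    cfc_nonneg fun x _ => sub_nonneg.2 (le_max_right _ _)
  have hle := re_trace_mul_le (smul_rpow_le_grad ht hw hA hXp (ha.trans_le hac) hc) hN0
  rw [hN, sub_mul, one_mul, trace_sub, Complex.sub_re, re_trace_cfc hXp.isHermitian] at hVI
  rw [PosDef.cfc_mul_rpow hXp] at hle
  refine algebraMap_le_of_eigenvalues hXp.isHermitian fun i => ?_
  by_contra! hi
  have hlt : ∑ i, (max c (hXp.isHermitian.eigenvalues i) - hXp.isHermitian.eigenvalues i) <
      ∑ i, c ^ (1 - t) * hXp.isHermitian.eigenvalues i ^ (t - 1) *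
        (max c (hXp.isHermitian.eigenvalues i) - hXp.isHermitian.eigenvalues i) := by
    refine Finset.sum_lt_sum (fun k _ => ?_) ⟨i, Finset.mem_univ i, ?_⟩
    · rcases le_or_gt c (hXp.isHermitian.eigenvalues k) with hk | hk
      · simp [max_eq_right hk]
      · exact le_mul_of_one_le_left (sub_nonneg.2 (le_max_right _ _))
          ((mul_rpow_compare_one ht (ha.trans_le hac) (hXp.eigenvalues_pos k)).1 hk).le
    · exact lt_mul_of_one_lt_left (sub_pos.2 (lt_max_of_lt_left hi))
        ((mul_rpow_compare_one ht (ha.trans_le hac) (hXp.eigenvalues_pos i)).1 hi)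
  linarith

/-- The mirror argument: lower the eigenvalues to at most `c`, using the upper bound on `grad`. -/
lemma le_algebraMap_of_isMinOn (ht : t ∈ Set.Ioo (0 : ℝ) 1) (hw : w ∈ stdSimplex ℝ (Fin n))
    (hA : ∀ j, (A j).PosDef) {X : Matrix (Fin m) (Fin m) ℂ} {a b c : ℝ} (ha : 0 < a)
    (hac : a ≤ c) (hcb : c ≤ b) (hc : ∀ j, A j ≤ algebraMap ℝ _ c)
    (hX : X ∈ Set.Icc (algebraMap ℝ (Matrix (Fin m) (Fin m) ℂ) a) (algebraMap ℝ _ b))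
    (hmin : IsMinOn (objective t w A) (Set.Icc (algebraMap ℝ _ a) (algebraMap ℝ _ b)) X) :
    X ≤ algebraMap ℝ _ c := by
  have hXp := posDef_of_algebraMap_le ha hX.1
  have hXs : IsSelfAdjoint X := hXp.isHermitian
  have hsa := (algebraMap_le_iff_le_spectrum (ha := hXs)).1 hX.1
  have hmin' : Continuous fun x : ℝ => min c x := by fun_prop
  have hY : cfc (fun x : ℝ => min c x) X ∈
      Set.Icc (algebraMap ℝ (Matrix (Fin m) (Fin m) ℂ) a) (algebraMap ℝ _ b) :=
    ⟨algebraMap_le_cfc _ _ _ (fun x hx => le_min hac (hsa x hx)) hmin'.continuousOn hXs,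
      cfc_le_algebraMap _ _ _ (fun x _ => (min_le_left _ _).trans hcb) hmin'.continuousOn hXs⟩
  have hVI := re_trace_one_sub_grad_nonneg ht hw hA (convex_Icc _ _)
    (fun Z hZ => posDef_of_algebraMap_le ha hZ.1) hX hY hmin
  have hN : cfc (fun x : ℝ => min c x) X - X = -cfc (fun x : ℝ => x - min c x) X := by
    rw [cfc_sub _ _ X continuous_id'.continuousOn hmin'.continuousOn, cfc_id' ℝ X, neg_sub]
  have hN0 : 0 ≤ cfc (fun x : ℝ => x - min c x) X :=
    cfc_nonneg fun x _ => sub_nonneg.2 (min_le_right _ _)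
  have hle := re_trace_mul_le (grad_le_smul_rpow ht hw hA hXp (ha.trans_le hac) hc) hN0
  rw [hN, mul_neg, trace_neg, Complex.neg_re, sub_mul, one_mul, trace_sub, Complex.sub_re,
    re_trace_cfc hXp.isHermitian] at hVI
  rw [PosDef.cfc_mul_rpow hXp] at hle
  refine le_algebraMap_of_eigenvalues hXp.isHermitian fun i => ?_
  by_contra! hi
  have hlt : ∑ i, c ^ (1 - t) * hXp.isHermitian.eigenvalues i ^ (t - 1) *
        (hXp.isHermitian.eigenvalues i - min c (hXp.isHermitian.eigenvalues i)) <
      ∑ i, (hXp.isHermitian.eigenvalues i - min c (hXp.isHermitian.eigenvalues i)) := by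
    refine Finset.sum_lt_sum (fun k _ => ?_) ⟨i, Finset.mem_univ i, ?_⟩
    · rcases le_or_gt (hXp.isHermitian.eigenvalues k) c with hk | hk
      · simp [min_eq_right hk]
      · exact mul_le_of_le_one_left (sub_nonneg.2 (min_le_right _ _))
          ((mul_rpow_compare_one ht (ha.trans_le hac) (hXp.eigenvalues_pos k)).2 hk).le
    · exact mul_lt_of_lt_one_left (sub_pos.2 (min_lt_of_left_lt hi))
        ((mul_rpow_compare_one ht (ha.trans_le hac) (hXp.eigenvalues_pos i)).2 hi)
  linarith

lemma exists_grad_eq_one (ht : t ∈ Set.Ioo (0 : ℝ) 1) (hw : w ∈ stdSimplex ℝ (Fin n))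
    (hA : ∀ j, (A j).PosDef) : ∃ X, X.PosDef ∧ grad t w A X = 1 := by
  obtain ⟨a, b, ha, hab, hAab⟩ := exists_algebraMap_bounds hA
  have hmono : ∀ r s : ℝ, r ≤ s →
      algebraMap ℝ (Matrix (Fin m) (Fin m) ℂ) r ≤ algebraMap ℝ _ s := fun r s h =>
    algebraMap_mono _ h
  -- The margin `a / 2` on both sides leaves room to move from a minimizer between `a` and `b` in
  -- any small Hermitian direction, while keeping `K` among positive definite matrices.
  set K := Set.Icc (algebraMap ℝ (Matrix (Fin m) (Fin m) ℂ) (a / 2)) (algebraMap ℝ _ (b + a / 2))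
  have hKpos : ∀ Z ∈ K, Z.PosDef := fun Z hZ => posDef_of_algebraMap_le (half_pos ha) hZ.1
  obtain ⟨X, hX, hmin⟩ := (isCompact_Icc_algebraMap (m := m) (b := b + a / 2)
    (half_pos ha)).exists_isMinOn ⟨algebraMap ℝ _ a, hmono _ _ (by linarith),
      hmono _ _ (by linarith)⟩ ((continuousOn_objective (t := t) (w := w) hA).mono hKpos)
  have hXp := hKpos X hX
  refine ⟨X, hXp, ?_⟩
  have hlo : algebraMap ℝ _ a ≤ X := algebraMap_le_of_isMinOn ht hw hA (half_pos ha)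
    (by linarith) (by linarith) (fun j => (hAab j).1) hX hmin
  have hhi : X ≤ algebraMap ℝ _ b := le_algebraMap_of_isMinOn ht hw hA (half_pos ha)
    (by linarith) (by linarith) (fun j => (hAab j).2) hX hmin
  have hG : (grad t w A X).IsHermitian := grad_isHermitian hA hXp
  set H := grad t w A X - 1 with hH
  have hHh : H.IsHermitian := hG.sub isHermitian_one
  obtain ⟨ε, hε, hεH⟩ : ∃ ε : ℝ, 0 < ε ∧ ‖ε • H‖ ≤ a / 2 := by
    refine ⟨a / 2 / (‖H‖ + 1), by positivity, ?_⟩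
    rw [norm_smul, Real.norm_of_nonneg (by positivity), div_mul_eq_mul_div,
      div_le_iff₀ (by positivity)]
    exact mul_le_mul_of_nonneg_left (by linarith) (half_pos ha).le
  have hεs : IsSelfAdjoint (ε • H) := (IsSelfAdjoint.all ε).smul hHh.isSelfAdjoint
  have hY : X + ε • H ∈ K := by
    constructor
    · have := add_le_add hlo (hεs.neg_algebraMap_norm_le_self)
      rw [← sub_eq_add_neg, ← map_sub] at this
      exact (hmono _ _ (by linarith)).trans this
    · have := add_le_add hhi (hεs.le_algebraMap_norm_self)
      rw [← map_add] at this
      exact this.trans (hmono _ _ (by linarith))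
  -- Moving along `H = grad - 1` turns the first order condition into `-ε * tr (Hᴴ * H) ≥ 0`, hence
  -- `H = 0`.
  have hVI := re_trace_one_sub_grad_nonneg ht hw hA (convex_Icc _ _) hKpos hX hY hmin
  have e : (1 - grad t w A X) * (X + ε • H - X) = -(ε • (Hᴴ * H)) := by
    rw [add_sub_cancel_left, hHh.eq, mul_smul_comm, ← smul_neg, ← neg_mul, hH, neg_sub]
  rw [e, trace_neg, Complex.neg_re, trace_smul, Complex.smul_re, smul_eq_mul] at hVI
  have hnn := (posSemidef_conjTranspose_mul_self H).trace_nonneg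
  have hre := (Complex.nonneg_iff.1 hnn).1
  have hzero : (Hᴴ * H).trace = 0 := by
    refine Complex.ext ?_ (Complex.nonneg_iff.1 hnn).2.symm
    have : 0 ≤ ε * (Hᴴ * H).trace.re := mul_nonneg hε.le hre
    have h0 : ε * (Hᴴ * H).trace.re = 0 := by linarith
    exact (mul_eq_zero.1 h0).resolve_left hε.ne'
  exact sub_eq_zero.1 (trace_conjTranspose_mul_self_eq_zero_iff.1 hzero)

lemma one_le_inv_of_le_one {m : ℕ} {B : Matrix (Fin m) (Fin m) ℂ} (hB : B.PosDef)
    (h : B ≤ 1) : 1 ≤ B⁻¹ := by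
  have h2 := CStarAlgebra.rpow_neg_one_le_rpow_neg_one h hB.isStrictlyPositive
  rw [CFC.one_rpow] at h2
  have e : B ^ (-1 : ℝ) * B = 1 := by
    nth_rw 2 [← CFC.rpow_one B hB.posSemidef.nonneg]
    rw [PosDef.rpow_mul_rpow hB, neg_add_cancel,
      CFC.rpow_zero B hB.posSemidef.nonneg]
  rwa [Matrix.inv_eq_left_inv e]

end

end ParamWasserstein

theorem mainTheorem9 {m n : ℕ} (t : ℝ) (ht : t ∈ Set.Ioo (0 : ℝ) 1)
    (w : Fin n → ℝ) (hw : w ∈ stdSimplex ℝ (Fin n))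
    (A : Fin n → Matrix (Fin m) (Fin m) ℂ) (hA : ∀ j, (A j).PosDef) :
    (∃! X, ParamWasserstein.IsMinimizer t w A X) ∧
    (1 ≤ ParamWasserstein.wassersteinMean t w A →
      1 ≤ ParamWasserstein.arithmeticMean w (fun j => A j ^ (1 - t))) ∧
    (ParamWasserstein.wassersteinMean t w A ≤ 1 →
      ParamWasserstein.wassersteinMean t w A ≤
        ParamWasserstein.harmonicMean w (fun j => A j ^ (t - 1))) := by
  obtain ⟨X, hX, hgrad⟩ := ParamWasserstein.exists_grad_eq_one ht hw hA
  have hXmin := ParamWasserstein.isMinimizer_of_grad_eq_one ht hw hA hX hgrad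
  have huniq : ∀ Y, ParamWasserstein.IsMinimizer t w A Y → Y = X := fun Y hY =>
    ParamWasserstein.eq_of_grad_eq_one ht hw hA hX hgrad hY
  have hmean : ParamWasserstein.wassersteinMean t w A = X := by
    have h : ∃ X, ParamWasserstein.IsMinimizer t w A X := ⟨X, hXmin⟩
    rw [ParamWasserstein.wassersteinMean, dif_pos h]
    exact huniq _ h.choose_spec
  refine ⟨⟨X, hXmin, huniq⟩, fun h => ?_, fun h => ?_⟩
  · rw [hmean] at h
    rw [← hgrad]
    refine ParamWasserstein.sum_smul_le_sum_smul hw fun j => ?_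
    rw [← ParamWasserstein.gradTerm_one ht (hA j)]
    exact ParamWasserstein.gradTerm_anti ht (hA j) Matrix.PosDef.one hX h
  · rw [hmean] at h ⊢
    refine h.trans ?_
    have hinv : ∀ j, (A j ^ (t - 1))⁻¹ = A j ^ (1 - t) := fun j => Matrix.inv_eq_left_inv <| by
      rw [ParamWasserstein.PosDef.rpow_mul_rpow (hA j), sub_add_sub_cancel, sub_self,
        CFC.rpow_zero (A j) (hA j).posSemidef.nonneg]
    have hle : ∑ j, w j • A j ^ (1 - t) ≤ 1 := by
      rw [← hgrad]
      refine ParamWasserstein.sum_smul_le_sum_smul hw fun j => ?_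
      rw [← ParamWasserstein.gradTerm_one ht (hA j)]
      exact ParamWasserstein.gradTerm_anti ht (hA j) hX Matrix.PosDef.one h
    -- Weights may vanish, but they sum to `1`, so some term is positive definite.
    have hpos : (∑ j, w j • A j ^ (1 - t)).PosDef := by
      obtain ⟨k, hk⟩ : ∃ k, w k ≠ 0 := by
        by_contra! h0
        have := hw.2
        simp [h0] at this
      rw [← Finset.add_sum_erase _ _ (Finset.mem_univ k)]
      refine ((ParamWasserstein.PosDef.rpow (hA k) _).smul
        (lt_of_le_of_ne (hw.1 k) hk.symm)).add_posSemidef ?_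
      exact Matrix.posSemidef_sum _ fun j _ =>
        (ParamWasserstein.PosDef.rpow (hA j) _).posSemidef.smul (hw.1 j)
    rw [ParamWasserstein.harmonicMean]
    simp only [hinv]
    exact ParamWasserstein.one_le_inv_of_le_one hpos hle
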